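/- Let $G$ be a complete graph on an infinite vertex set whose edges are colored (with an arbitrary set of colors). A cycle of $G$ is rainbow if no two of its edges have the same color. Let $$\mathrm{Sp}(G)=\{n\ge 2 : \text{no cycle of length } n \text{ in } G \text{ is rainbow}\},$$ where $2\in \mathrm{Sp}(G)$ since $G$ has no cycles of length $2$. Let the period $\mathrm{per}(G)$ of $\mathrm{Sp}(G)$ be the least positive integer $d$ such that $\{N+jd : j\ge 0\}\subseteq \mathrm{Sp}(G)$ for some integer $N\ge 0$. Let $p(n)=1$ if $n$ is odd, $p(n)=2$ if $n$ is divisible by $4$, and $p(n)=4$ otherwise. Suppose that $n\in\mathrm{Sp}(G)$. (i) If $n\ge 3$ is odd, there is an integer $N\ge 0$ with $N\le 2n^2-13n+23$ such that $\{N+j : j\ge 0\}\subseteq \mathrm{Sp}(G)$. (ii) If $n\ge 6$ and $n\equiv 2 \pmod 4$, there is an integer $N\ge 0$ with $N\le \frac94 n^2-18n+37$ such that $\{N+4j : j\ge 0\}\subseteq \mathrm{Sp}(G)$. (iii) If $n\equiv 0\pmod 4$, there is an integer $N\ge 0$ with $N\le \frac92 n^2-39n+86$ such that $\{N+2j : j\ge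 0\}\subseteq \mathrm{Sp}(G)$. Consequently, if $n\ge 3$, then $\mathrm{per}(G)$ exists and divides $p(n)$; in particular, it divides $4$ (Alexeev's conjecture). -/

import Mathlib

namespace RainbowCycle

/-- A closed walk in the complete graph on `V`, whose edges are colored by `γ`, is rainbow if no two
distinct edges on it have the same color. -/
def IsRainbow {V C : Type*} (γ : SimpleGraph.TopEdgeLabeling V C) {v : V}
    (w : (⊤ : SimpleGraph V).Walk v v) : Prop :=
  ∀ e f : (⊤ : SimpleGraph V).edgeSet,
    (e : Sym2 V) ∈ w.edges → (f : Sym2 V) ∈ w.edges → γ e = γ f → e = f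

/-- The spectrum of a complete edge-colored graph: all `n ≥ 2` such that no `n`-cycle is rainbow.
There are no `2`-cycles in a simple graph, so `2` always belongs to the spectrum. -/
def spectrum {V C : Type*} (γ : SimpleGraph.TopEdgeLabeling V C) : Set ℕ :=
  {n | 2 ≤ n ∧ ∀ (v : V) (w : (⊤ : SimpleGraph V).Walk v v),
    w.IsCycle → w.length = n → ¬ IsRainbow γ w}

/-- `S` contains the arithmetic progression `N, N + d, N + 2 d, …`. -/
def ContainsProgression (S : Set ℕ) (N d : ℕ) : Prop :=
  ∀ j : ℕ, N + j * d ∈ S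

/-- The least positive `d` such that `S` contains an infinite arithmetic progression of
difference `d`. The value is `0` if there is no such `d`, and `0` divides no positive integer. -/
noncomputable def period (S : Set ℕ) : ℕ :=
  sInf {d | 0 < d ∧ ∃ N, ContainsProgression S N d}

/-- `1` for odd `n`, `2` for `n` divisible by four, and `4` otherwise. -/
def p (n : ℕ) : ℕ :=
  if n % 2 = 1 then 1 else if n % 4 = 0 then 2 else 4

end RainbowCycle

/-!
Write `k = n - 2` and call a length forbidden if it belongs to the spectrum. Suppose that cycles of
length `k + 2` are forbidden and that there is a rainbow cycle of length `m`, with vertices `v x`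
indexed by `x : ℤ` modulo `m`.

*Chords.* A chord that closes up a path of `s + 1` edges of the cycle to a cycle of a forbidden
length `s + 2` repeats the color of an edge of this path (`RainbowLap.chordColor`). Hence the
forbidden lengths, lowered by two, form a submonoid of `ℕ` (`spectrumMonoid`), and each chord of
length `a * k + 1` has the color of one of the edges that it cuts off.

*Propagation.* Chords of this kind can be combined with edges of the cycle to closed sequences of
`k + 2` vertices that wind once around the cycle and overshoot the starting point by a small number
`q`, which is made up for by `q` backward steps. Since such a sequence is not rainbow, a chord that
does not take its color from its first `q` edges forces another chord to take its color from its
last `q` edges (`RainbowLap.chordColor_last`). Iterating this around the cycle, either all chords of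
a certain length take their colors from their first `q` edges, or all take them from their last `q`
edges, and up to reversing the cycle the former holds (`RainbowLap.exists_low_of_closed`).

*Winding.* Now a closed sequence of `k + 2` forward steps, each along an edge or such a chord, that
winds several times around the cycle is rainbow as soon as the starting points of its chords are far
enough apart, which contradicts the assumption on `k + 2`. In this way `4 * k - 4` (for even `k`),
and `3 * k - 1` and `6 * k - 6` (for odd `k`) are shown to belong to the submonoid. For the odd
values `k = 5` and `k = 3` the stated bound needs a few more elements: `26` and `27`, obtained in the
same way, and `7`, which requires an analysis of chords of length three in a cycle of length nine.

*Arithmetic.* The stated bounds follow by computing with the submonoid generated by `k` and the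
elements found: `{k, 4 * k - 4}` for even `k`, and `{k, 3 * k - 1, 6 * k - 6, 8 * k - 4}` for odd
`k ≥ 7`, where `8 * k - 4` comes from the even element `2 * k`.
-/

namespace RainbowCycle

variable {V C κ : Type*}

/-! ### Rainbow cycles as sequences of vertices -/

/-- The coloring `c` has a rainbow cycle of length `n`, given by its sequence of vertices
`u 0, …, u (n - 1), u n = u 0`. -/
def HasRainbowCycle (c : V → V → κ) (n : ℕ) : Prop :=
  ∃ u : ℕ → V, u n = u 0 ∧ Set.InjOn u (Set.Iio n) ∧
    Set.InjOn (fun i => c (u i) (u (i + 1))) (Set.Iio n)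

open Classical in
/-- An edge labeling as a function of two vertices. The value on the diagonal is `none`. -/
noncomputable def edgeColor (γ : SimpleGraph.TopEdgeLabeling V C) (x y : V) : Option C :=
  if h : x ≠ y then some (γ ⟨s(x, y), by simpa using h⟩) else none

lemma edgeColor_of_ne (γ : SimpleGraph.TopEdgeLabeling V C) {x y : V} (h : x ≠ y) :
    edgeColor γ x y = some (γ ⟨s(x, y), by simpa using h⟩) := by
  simp [edgeColor, h]

lemma edgeColor_comm (γ : SimpleGraph.TopEdgeLabeling V C) (x y : V) :
    edgeColor γ x y = edgeColor γ y x := by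
  by_cases h : x = y
  · rw [h]
  · rw [edgeColor_of_ne γ h, edgeColor_of_ne γ (Ne.symm h)]
    congr 3
    exact Sym2.eq_swap

/-- The walk in the complete graph along a sequence of vertices. -/
def walkOfSeq (u : ℕ → V) : (n : ℕ) → (∀ i < n, u i ≠ u (i + 1)) →
    (⊤ : SimpleGraph V).Walk (u 0) (u n)
  | 0, _ => .nil
  | n + 1, h => (walkOfSeq u n fun i hi => h i (hi.trans n.lt_succ_self)).concat
      (by simpa using h n n.lt_succ_self)

lemma length_walkOfSeq (u : ℕ → V) (n : ℕ) (h : ∀ i < n, u i ≠ u (i + 1)) :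
    (walkOfSeq u n h).length = n := by
  induction n with
  | zero => rfl
  | succ n ih => simp [walkOfSeq, ih]

lemma support_walkOfSeq (u : ℕ → V) (n : ℕ) (h : ∀ i < n, u i ≠ u (i + 1)) :
    (walkOfSeq u n h).support = (List.range (n + 1)).map u := by
  induction n with
  | zero => rfl
  | succ n ih =>
    rw [walkOfSeq, SimpleGraph.Walk.support_concat, ih, List.range_succ (n := n + 1)]
    simp

lemma edges_walkOfSeq (u : ℕ → V) (n : ℕ) (h : ∀ i < n, u i ≠ u (i + 1)) :
    (walkOfSeq u n h).edges = (List.range n).map fun i => s(u i, u (i + 1)) := by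
  induction n with
  | zero => rfl
  | succ n ih =>
    rw [walkOfSeq, SimpleGraph.Walk.edges_concat, ih, List.range_succ (n := n)]
    simp

lemma not_hasRainbowCycle_of_mem_spectrum {γ : SimpleGraph.TopEdgeLabeling V C} {n : ℕ}
    (hn : n ∈ spectrum γ) : ¬ HasRainbowCycle (edgeColor γ) n := by
  rintro ⟨u, hclose, hu, hcol⟩
  obtain ⟨hn2, hn⟩ := hn
  have hne : ∀ i < n, u i ≠ u (i + 1) := by
    intro i hi h
    rcases Nat.lt_or_ge (i + 1) n with h1 | h1
    · have := hu (Set.mem_Iio.2 hi) (Set.mem_Iio.2 h1) h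
      omega
    · obtain rfl : n = i + 1 := by omega
      rw [hclose] at h
      have := hu (Set.mem_Iio.2 hi) (Set.mem_Iio.2 (by omega : 0 < i + 1)) h
      omega
  -- a sequence of length two runs through the same edge twice
  have hn3 : 3 ≤ n := by
    by_contra hlt
    obtain rfl : n = 2 := by omega
    have : (0 : ℕ) = 1 := hcol (Set.mem_Iio.2 (by omega)) (Set.mem_Iio.2 (by omega))
      (by change edgeColor γ (u 0) (u 1) = edgeColor γ (u 1) (u 2); rw [hclose, edgeColor_comm])
    omega
  have hedge : ∀ i < n, ∀ j < n, s(u i, u (i + 1)) = s(u j, u (j + 1)) → i = j := by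
    intro i hi j hj h
    refine hcol (Set.mem_Iio.2 hi) (Set.mem_Iio.2 hj) ?_
    simp only [edgeColor_of_ne γ (hne i hi), edgeColor_of_ne γ (hne j hj)]
    congr 2
    exact Subtype.ext h
  let w : (⊤ : SimpleGraph V).Walk (u 0) (u 0) := (walkOfSeq u n hne).copy rfl hclose
  have hwl : w.length = n := by simp [w, length_walkOfSeq]
  have hws : w.support = (List.range (n + 1)).map u := by simp [w, support_walkOfSeq]
  have hwe : w.edges = (List.range n).map fun i => s(u i, u (i + 1)) := by
    simp [w, edges_walkOfSeq]
  have hcyc : w.IsCycle := by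
    rw [SimpleGraph.Walk.isCycle_def]
    refine ⟨⟨?_⟩, ?_, ?_⟩
    · rw [hwe]
      refine List.Nodup.map_on ?_ List.nodup_range
      intro i hi j hj h
      exact hedge i (List.mem_range.1 hi) j (List.mem_range.1 hj) h
    · intro h
      rw [h] at hwl
      simp at hwl
      omega
    · rw [hws, List.range_succ_eq_map, List.map_cons, List.tail_cons, List.map_map]
      refine List.Nodup.map_on ?_ List.nodup_range
      intro i hi j hj h
      rw [List.mem_range] at hi hj
      have key : ∀ a < n, ∃ b < n, u (a + 1) = u b ∧ (b = a + 1 ∨ b = 0 ∧ a + 1 = n) := by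
        intro a ha
        rcases Nat.lt_or_ge (a + 1) n with h1 | h1
        · exact ⟨a + 1, h1, rfl, .inl rfl⟩
        · obtain rfl : n = a + 1 := by omega
          exact ⟨0, by omega, hclose, .inr ⟨rfl, rfl⟩⟩
      obtain ⟨b, hb, hub, hb'⟩ := key i hi
      obtain ⟨d, hd, hud, hd'⟩ := key j hj
      have : b = d := hu (Set.mem_Iio.2 hb) (Set.mem_Iio.2 hd)
        (hub.symm.trans (Eq.trans h hud))
      omega
  refine hn (u 0) w hcyc hwl ?_
  rintro ⟨e, he⟩ ⟨f, hf⟩ hew hfw hef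
  simp only [hwe, List.mem_map, List.mem_range] at hew hfw
  obtain ⟨i, hi, rfl⟩ := hew
  obtain ⟨j, hj, rfl⟩ := hfw
  have : i = j := by
    refine hcol (Set.mem_Iio.2 hi) (Set.mem_Iio.2 hj) ?_
    simp only [edgeColor_of_ne γ (hne i hi), edgeColor_of_ne γ (hne j hj)]
    exact congrArg some hef
  subst this
  rfl

lemma mem_spectrum_of_not_hasRainbowCycle {γ : SimpleGraph.TopEdgeLabeling V C} {n : ℕ}
    (hn2 : 2 ≤ n) (hn : ¬ HasRainbowCycle (edgeColor γ) n) : n ∈ spectrum γ := by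
  refine ⟨hn2, fun v w hw hwl hr => hn ⟨w.getVert, ?_, ?_, ?_⟩⟩
  · rw [← hwl, SimpleGraph.Walk.getVert_length, SimpleGraph.Walk.getVert_zero]
  · intro i hi j hj h
    rw [Set.mem_Iio] at hi hj
    exact hw.getVert_injOn' (by simp only [Set.mem_ofPred_eq]; omega)
      (by simp only [Set.mem_ofPred_eq]; omega) h
  · intro i hi j hj h
    rw [Set.mem_Iio] at hi hj
    have hmem : ∀ a < n, ∃ h : a < w.edges.length,
        w.edges[a] = s(w.getVert a, w.getVert (a + 1)) := by
      intro a ha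
      have h' : a < w.edges.length := by rw [SimpleGraph.Walk.length_edges]; omega
      exact ⟨h', SimpleGraph.Walk.getElem_edges h'⟩
    have hadj : ∀ a < n, w.getVert a ≠ w.getVert (a + 1) := fun a ha =>
      (w.adj_getVert_succ (by omega)).ne
    obtain ⟨hi', hie⟩ := hmem i hi
    obtain ⟨hj', hje⟩ := hmem j hj
    simp only [edgeColor_of_ne γ (hadj i hi), edgeColor_of_ne γ (hadj j hj)] at h
    have hi'' := List.getElem_mem hi'
    have hj'' := List.getElem_mem hj'
    rw [hie] at hi''
    rw [hje] at hj''
    have := hr _ _ hi'' hj'' (Option.some_injective _ h)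
    have h2 : w.edges[i] = w.edges[j] := by
      rw [hie, hje]; exact congrArg Subtype.val this
    exact (List.Nodup.getElem_inj_iff hw.edges_nodup).1 h2

/-! ### Laps around a rainbow cycle -/

/-- A rainbow cycle of length `m`, read off as an `m`-periodic sequence of vertices indexed by `ℤ`.
Indices are congruent modulo `m` as soon as their vertices agree, or the colors of the edges to the
next vertex agree. -/
structure RainbowLap (c : V → V → κ) (m : ℕ) (v : ℤ → V) : Prop where
  periodic : ∀ x, v (x + m) = v x
  dvd_of_vertex_eq : ∀ x y, v x = v y → (m : ℤ) ∣ x - y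
  dvd_of_color_eq : ∀ x y, c (v x) (v (x + 1)) = c (v y) (v (y + 1)) → (m : ℤ) ∣ x - y

lemma HasRainbowCycle.exists_lap {c : V → V → κ} {m : ℕ} (hm : 0 < m)
    (h : HasRainbowCycle c m) : ∃ v, RainbowLap c m v := by
  obtain ⟨u, hclose, hu, hcol⟩ := h
  have hm' : (0 : ℤ) < m := by exact_mod_cast hm
  have hlt : ∀ x : ℤ, (x % m).toNat < m := fun x => by
    have := Int.emod_lt_of_pos x hm'
    omega
  have hdvd : ∀ x y : ℤ, (x % m).toNat = (y % m).toNat → (m : ℤ) ∣ x - y := by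
    intro x y h
    have hx := Int.emod_nonneg x hm'.ne'
    have hy := Int.emod_nonneg y hm'.ne'
    exact Int.ModEq.dvd (show y % m = x % m by omega)
  have hsucc : ∀ x : ℤ, u ((x + 1) % m).toNat = u ((x % m).toNat + 1) := by
    intro x
    have hx := Int.emod_nonneg x hm'.ne'
    have hx' := Int.emod_lt_of_pos x hm'
    have h1 : (x + 1) % m = (x % m + 1) % m := by simp [Int.add_emod]
    rw [h1]
    rcases (by omega : x % m + 1 < m ∨ x % m + 1 = m) with h2 | h2
    · rw [Int.emod_eq_of_lt (by omega) h2]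
      congr 1
      omega
    · rw [h2, Int.emod_self, show (x % m).toNat + 1 = m by omega, hclose]
      rfl
  refine ⟨fun x => u (x % m).toNat, fun x => by simp, fun x y hxy => ?_, fun x y hxy => ?_⟩
  · exact hdvd x y (hu (Set.mem_Iio.2 (hlt x)) (Set.mem_Iio.2 (hlt y)) hxy)
  · simp only [hsucc] at hxy
    exact hdvd x y (hcol (Set.mem_Iio.2 (hlt x)) (Set.mem_Iio.2 (hlt y)) hxy)

namespace RainbowLap

variable {c : V → V → κ} {m : ℕ} {v : ℤ → V}

lemma periodic_mul (h : RainbowLap c m v) (x a : ℤ) : v (x + a * m) = v x := by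
  have := Function.Periodic.int_mul (f := v) (c := (m : ℤ)) h.periodic a x
  simpa using this

lemma vertex_eq_of_dvd (h : RainbowLap c m v) {x y : ℤ} (hxy : (m : ℤ) ∣ x - y) : v x = v y := by
  obtain ⟨a, ha⟩ := hxy
  rw [← h.periodic_mul y a]
  congr 1
  linarith

/-- A lap traversed from another starting point. -/
lemma shift (h : RainbowLap c m v) (a : ℤ) : RainbowLap c m fun x => v (x + a) where
  periodic x := by rw [← h.periodic (x + a)]; congr 1; ring
  dvd_of_vertex_eq x y hxy := by simpa using h.dvd_of_vertex_eq _ _ hxy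
  dvd_of_color_eq x y hxy := by
    have := h.dvd_of_color_eq (x + a) (y + a)
      (by rwa [show x + a + 1 = x + 1 + a by ring, show y + a + 1 = y + 1 + a by ring])
    simpa using this

/-- A lap traversed backwards. -/
lemma reverse (hc : ∀ x y, c x y = c y x) (h : RainbowLap c m v) :
    RainbowLap c m fun x => v (-x) where
  periodic x := by
    have := h.periodic (-(x + m))
    rw [← this]
    congr 1
    ring
  dvd_of_vertex_eq x y hxy := by
    have := h.dvd_of_vertex_eq _ _ hxy
    rwa [← dvd_neg, show -(-x - -y) = x - y by ring] at this
  dvd_of_color_eq x y hxy := by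
    have := h.dvd_of_color_eq (-(x + 1)) (-(y + 1)) (by
      rw [hc, hc (v (-(y + 1)))]
      simpa using hxy)
    rwa [← dvd_neg, show -(-(x + 1) - -(y + 1)) = x - y by ring] at this

/-- The indices of a window of length `m` are determined by the colors of their edges. -/
lemma eq_of_color_eq (h : RainbowLap c m v) {x y : ℤ} (hxy : |x - y| < m)
    (hcol : c (v x) (v (x + 1)) = c (v y) (v (y + 1))) : x = y := by
  have := Int.eq_zero_of_abs_lt_dvd (h.dvd_of_color_eq x y hcol) hxy
  omega

/-- If there is no rainbow cycle of length `n`, then a closed sequence of `n` distinct vertices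
`v (P i)`, all of whose edges have colors of the lap, repeats a color. -/
lemma exists_color_repetition (h : RainbowLap c m v) {n : ℕ} (hn : ¬ HasRainbowCycle c n)
    (P K : ℕ → ℤ) (B : ℤ) (hB : ∀ i < n, B ≤ P i ∧ P i < B + m)
    (hP : ∀ i < n, ∀ j < n, P i = P j → i = j) (hclose : (m : ℤ) ∣ P n - P 0)
    (hK : ∀ i < n, c (v (P i)) (v (P (i + 1))) = c (v (K i)) (v (K i + 1))) :
    ∃ i j, i < j ∧ j < n ∧ (m : ℤ) ∣ K i - K j := by
  by_contra! hcon
  refine hn ⟨fun i => v (P i), h.vertex_eq_of_dvd hclose, ?_, ?_⟩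
  · intro i hi j hj hij
    have hdvd := h.dvd_of_vertex_eq _ _ hij
    have hi' := hB i hi
    have hj' := hB j hj
    have := Int.eq_zero_of_abs_lt_dvd hdvd (by rw [abs_lt]; constructor <;> omega)
    exact hP i hi j hj (by omega)
  · intro i hi j hj hij
    simp only [hK i hi, hK j hj] at hij
    have hdvd := h.dvd_of_color_eq _ _ hij
    rcases lt_trichotomy i j with hlt | rfl | hlt
    · exact absurd hdvd (hcon i j hlt hj)
    · rfl
    · exact absurd ((dvd_neg.2 hdvd)) (by rw [neg_sub]; exact hcon j i hlt hi)

/-- A closed sequence of `n` distinct vertices whose edges have distinct colors of the lap, as a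
rainbow cycle. Both the vertices and the colors are given by indices from a window of length `m`. -/
lemma hasRainbowCycle (h : RainbowLap c m v) {n : ℕ} (P K : ℕ → ℤ)
    (hB : ∀ i < n, 0 ≤ P i ∧ P i < m) (hP : ∀ i < n, ∀ j < n, P i = P j → i = j)
    (hclose : (m : ℤ) ∣ P n - P 0)
    (hK : ∀ i < n, c (v (P i)) (v (P (i + 1))) = c (v (K i)) (v (K i + 1)))
    (hKB : ∀ i < n, 0 ≤ K i ∧ K i < m) (hKinj : ∀ i < n, ∀ j < n, K i = K j → i = j) :
    HasRainbowCycle c n := by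
  by_contra hn
  obtain ⟨i, j, hij, hj, hdvd⟩ :=
    h.exists_color_repetition hn P K 0 (by simpa using hB) hP hclose hK
  have hi' := hKB i (by omega)
  have hj' := hKB j hj
  have := Int.eq_zero_of_abs_lt_dvd hdvd (by rw [abs_lt]; constructor <;> omega)
  have := hKinj i (by omega) j hj (by omega)
  omega

end RainbowLap

/-! ### Chords -/

/-- The chord of a lap from index `x` to index `x + L` has the color of one of the edges that it
cuts off, the `t`-th of which starts at index `x + t`, where moreover `a ≤ t < b`. -/
def ChordColor (c : V → V → κ) (v : ℤ → V) (L a b x : ℤ) : Prop :=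
  ∃ t, a ≤ t ∧ t < b ∧ c (v x) (v (x + L)) = c (v (x + t)) (v (x + t + 1))

lemma ChordColor.mono {c : V → V → κ} {v : ℤ → V} {L a b a' b' x : ℤ}
    (h : ChordColor c v L a b x) (ha : a' ≤ a) (hb : b ≤ b') : ChordColor c v L a' b' x := by
  obtain ⟨t, h1, h2, h3⟩ := h
  exact ⟨t, by omega, by omega, h3⟩

/-- Each chord of length `1` is an edge of the lap. -/
lemma chordColor_one (c : V → V → κ) (v : ℤ → V) (x : ℤ) : ChordColor c v 1 0 1 x :=
  ⟨0, le_rfl, one_pos, by simp⟩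

namespace RainbowLap

variable {c : V → V → κ} {m : ℕ} {v : ℤ → V}

/-- A chord that closes up a path of `s + 1` edges to a cycle of a forbidden length `s + 2`
repeats a color of this path. -/
lemma chordColor (hc : ∀ x y, c x y = c y x) (h : RainbowLap c m v) {s : ℕ}
    (hs : ¬ HasRainbowCycle c (s + 2)) (hsm : s + 1 < m) (x : ℤ) :
    ChordColor c v (s + 1) 0 (s + 1) x := by
  by_contra hcon
  have hcon' : ∀ i < s + 1, c (v x) (v (x + (s + 1))) ≠ c (v (x + i)) (v (x + i + 1)) :=
    fun i hi heq => hcon ⟨i, by omega, by omega, heq⟩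
  have hlt : ∀ i < s + 2, (if i < s + 2 then x + (i : ℤ) else x) = x + i :=
    fun i hi => if_pos hi
  refine hs ⟨fun i => v (if i < s + 2 then x + (i : ℤ) else x), by simp, ?_, ?_⟩
  · intro i hi j hj hij
    rw [Set.mem_Iio] at hi hj
    simp only [hi, hj, if_true] at hij
    have := Int.eq_zero_of_abs_lt_dvd (h.dvd_of_vertex_eq _ _ hij)
      (by rw [abs_lt]; constructor <;> omega)
    omega
  · have hcol : ∀ i < s + 1,
        c (v (if i < s + 2 then x + (i : ℤ) else x))
          (v (if i + 1 < s + 2 then x + ((i + 1 : ℕ) : ℤ) else x)) =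
        c (v (x + i)) (v (x + i + 1)) := by
      intro i hi
      rw [if_pos (by omega), if_pos (by omega)]
      push_cast
      rw [add_assoc]
    have hlast : c (v (if s + 1 < s + 2 then x + ((s + 1 : ℕ) : ℤ) else x))
          (v (if s + 1 + 1 < s + 2 then x + ((s + 1 + 1 : ℕ) : ℤ) else x)) =
        c (v x) (v (x + (s + 1))) := by
      rw [if_pos (by omega), if_neg (by omega), hc]
      push_cast
      rfl
    intro i hi j hj hij
    rw [Set.mem_Iio] at hi hj
    simp only at hij
    rcases (by omega : i < s + 1 ∨ i = s + 1) with hi' | rfl <;>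
      rcases (by omega : j < s + 1 ∨ j = s + 1) with hj' | rfl
    · rw [hcol i hi', hcol j hj'] at hij
      have := h.eq_of_color_eq (by rw [abs_lt]; constructor <;> omega) hij
      omega
    · rw [hcol i hi', hlast] at hij
      exact absurd hij.symm (hcon' i hi')
    · rw [hcol j hj', hlast] at hij
      exact absurd hij (hcon' j hj')
    · rfl

/-- Chords are periodic along the lap. -/
lemma chordColor_periodic (h : RainbowLap c m v) {L a b x : ℤ} (r : ℤ)
    (hx : ChordColor c v L a b x) : ChordColor c v L a b (x + r * m) := by
  obtain ⟨t, h1, h2, h3⟩ := hx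
  refine ⟨t, h1, h2, ?_⟩
  rw [h.periodic_mul, show x + r * m + L = x + L + r * m by ring,
    show x + r * m + t = x + t + r * m by ring, show x + t + r * m + 1 = x + t + 1 + r * m by ring,
    h.periodic_mul, h.periodic_mul, h.periodic_mul, h3]

/-- The color of a chord determines the edge it shares the color with. -/
lemma not_chordColor_of_le (h : RainbowLap c m v) {L a b a' b' x : ℤ} (ha : 0 ≤ a)
    (hb : b ≤ a') (hb' : b' ≤ m) (hx : ChordColor c v L a b x) : ¬ ChordColor c v L a' b' x := by
  obtain ⟨t, h1, h2, h3⟩ := hx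
  rintro ⟨r, h4, h5, h6⟩
  have := h.eq_of_color_eq (by rw [abs_lt]; constructor <;> omega) (h3.symm.trans h6)
  omega

lemma chordColor_reverse (hc : ∀ x y, c x y = c y x) {L a b x : ℤ}
    (hx : ChordColor c v L a b (-x - L)) :
    ChordColor c (fun x => v (-x)) L (L - b) (L - a) x := by
  obtain ⟨t, h1, h2, h3⟩ := hx
  refine ⟨L - 1 - t, by omega, by omega, ?_⟩
  simp only
  rw [hc, show -(x + L) = -x - L by ring, show -(x + (L - 1 - t)) = -x - L + t + 1 by ring,
    show -(x + (L - 1 - t) + 1) = -x - L + t by ring, hc (v (-x - L + t + 1)), ← h3]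
  congr 2
  ring

end RainbowLap

/-- The forbidden lengths, lowered by two, are closed under addition: a chord cutting a rainbow
cycle of length `a + b + 2` into cycles of lengths `a + 2` and `b + 2` would repeat a color on both
sides. -/
lemma not_hasRainbowCycle_add {c : V → V → κ} (hc : ∀ x y, c x y = c y x)
    {a b : ℕ} (ha : ¬ HasRainbowCycle c (a + 2)) (hb : ¬ HasRainbowCycle c (b + 2)) :
    ¬ HasRainbowCycle c (a + b + 2) := by
  intro hab
  obtain ⟨v, h⟩ := hab.exists_lap (by omega)
  obtain ⟨t, ht0, ht, htc⟩ := h.chordColor hc ha (by omega) 0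
  obtain ⟨r, hr0, hr, hrc⟩ := h.chordColor hc hb (by omega) (a + 1)
  have hclose : v (↑a + 1 + (↑b + 1)) = v 0 := h.vertex_eq_of_dvd ⟨1, by push_cast; ring⟩
  rw [hclose, hc, show (a : ℤ) + 1 = 0 + (a + 1) by ring, htc] at hrc
  have := h.eq_of_color_eq (by rw [abs_lt]; push_cast; constructor <;> omega) hrc
  omega

/-! ### Propagation of chord colors -/

lemma eq_of_dvd_of_abs_lt_two_mul {m d : ℤ} (h : m ∣ d) (hd : |d| < 2 * m) :
    d = 0 ∨ d = m ∨ d = -m := by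
  obtain ⟨a, rfl⟩ := h
  rw [abs_lt] at hd
  have hm : 0 < m := by linarith
  have h1 : a < 2 := by nlinarith
  have h2 : -2 < a := by nlinarith
  obtain rfl | rfl | rfl : a = -1 ∨ a = 0 ∨ a = 1 := by omega
  all_goals simp

namespace RainbowLap

variable {c : V → V → κ} {m : ℕ} {v : ℤ → V}

/-- A cycle of forbidden length that winds once around the lap: three chords of lengths `L₁`, `L₂`,
`L₃`, with `p` edges of the lap between the first two, overshoot the starting point `x` by `q`, and
`q` edges lead back to `x`. The only way for it to repeat a color is that the first chord has the
color of one of its first `q` edges, or the last chord has the color of one of its last `q`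
edges. -/
lemma chordColor_last (hc : ∀ x y, c x y = c y x) (h : RainbowLap c m v) {p q : ℕ}
    (hn : ¬ HasRainbowCycle c (p + q + 3)) {L₁ L₂ L₃ : ℤ}
    (hm : (m : ℤ) + q = L₁ + p + L₂ + L₃) (hL₁ : q < L₁) (hL₂ : 0 < L₂) (hL₃ : q < L₃)
    (h₁ : ∀ x, ChordColor c v L₁ 0 L₁ x) (h₂ : ∀ x, ChordColor c v L₂ 0 L₂ x)
    (h₃ : ∀ x, ChordColor c v L₃ 0 L₃ x) {x : ℤ} (hx : ¬ ChordColor c v L₁ 0 q x) :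
    ChordColor c v L₃ (L₃ - q) L₃ (x + q - L₃) := by
  obtain ⟨a, ha0, ha, hac⟩ := h₁ x
  obtain ⟨g, hg0, hg, hgc⟩ := h₂ (x + L₁ + p)
  obtain ⟨b, hb0, hb, hbc⟩ := h₃ (x + q - L₃)
  have haq : q ≤ a := by
    by_contra hlt
    exact hx ⟨a, ha0, by omega, hac⟩
  refine ⟨b, ?_, hb, hbc⟩
  by_contra hbq
  let P : ℕ → ℤ := fun i => if i = 0 then x else if i ≤ p + 1 then x + L₁ + i - 1
    else if i = p + 2 then x + q - L₃ + m else x + q + p + 3 - i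
  let K : ℕ → ℤ := fun i => if i = 0 then x + a else if i ≤ p then x + L₁ + i - 1
    else if i = p + 1 then x + L₁ + p + g
    else if i = p + 2 then x + q - L₃ + b else x + q + p + 2 - i
  have hrep : ∃ i j, i < j ∧ j < p + q + 3 ∧ (m : ℤ) ∣ K i - K j := by
    refine h.exists_color_repetition hn P K x ?_ ?_ ?_ ?_
    · intro i hi
      simp only [P]
      split_ifs <;> constructor <;> omega
    · intro i hi j hj
      simp only [P]
      split_ifs <;> omega
    · have e1 : P (p + q + 3) = x := by
        simp only [P]
        rw [if_neg (by omega), if_neg (by omega), if_neg (by omega)]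
        push_cast
        ring
      have e2 : P 0 = x := rfl
      rw [e1, e2, sub_self]
      exact dvd_zero _
    · intro i hi
      rcases (by omega : i = 0 ∨ (1 ≤ i ∧ i ≤ p) ∨ i = p + 1 ∨ i = p + 2 ∨ p + 3 ≤ i)
        with rfl | h1 | rfl | rfl | h1
      · simpa [P, K] using hac
      · simp only [P, K, if_neg (show i ≠ 0 by omega), if_pos (show i ≤ p + 1 by omega),
          if_neg (show i + 1 ≠ 0 by omega), if_pos (show i + 1 ≤ p + 1 by omega), if_pos h1.2]
        congr 2
        push_cast
        ring
      · have e1 : P (p + 1) = x + L₁ + p := by simp [P]; ring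
        have e2 : P (p + 1 + 1) = x + L₁ + p + L₂ := by simp [P]; linarith
        have e3 : K (p + 1) = x + L₁ + p + g := by simp [K]
        rw [e1, e2, e3, hgc]
      · have e1 : P (p + 2) = x + q - L₃ + m := by simp [P]
        have e2 : P (p + 2 + 1) = x + q - L₃ + L₃ := by simp [P]; ring
        have e3 : K (p + 2) = x + q - L₃ + b := by simp [K]
        rw [e1, e2, e3, h.periodic, hbc]
      · have e1 : P i = x + q + p + 2 - i + 1 := by
          simp only [P]
          rw [if_neg (by omega), if_neg (by omega), if_neg (by omega)]
          ring
        have e2 : P (i + 1) = x + q + p + 2 - i := by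
          simp only [P]
          rw [if_neg (by omega), if_neg (by omega), if_neg (by omega)]
          push_cast
          ring
        have e3 : K i = x + q + p + 2 - i := by
          simp only [K]
          rw [if_neg (by omega), if_neg (by omega), if_neg (by omega), if_neg (by omega)]
        rw [e1, e2, e3, hc]
  obtain ⟨i, j, hij, hj, hdvd⟩ := hrep
  have habs : |K i - K j| < 2 * m := by
    rw [abs_lt]
    simp only [K]
    constructor <;> split_ifs <;> omega
  have hcases := eq_of_dvd_of_abs_lt_two_mul hdvd habs
  simp only [K] at hcases
  clear hdvd habs
  split_ifs at hcases <;> omega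

end RainbowLap

/-- A set of residues modulo `m` that is closed under adding `a`, where `a` is a unit modulo `m`, is
empty or full. -/
lemma forall_of_closed {S : ℤ → Prop} {m : ℕ} (hm : 0 < m)
    (hper : ∀ x r, S x → S (x + r * m)) {a x₀ : ℤ} (hco : IsCoprime a m)
    (ha : ∀ x, S x → S (x + a)) (h0 : S x₀) (y : ℤ) : S y := by
  have hmul : ∀ r : ℕ, ∀ x, S x → S (x + r * a) := by
    intro r
    induction r with
    | zero => intro x hx; simpa using hx
    | succ r ih =>
      intro x hx
      have := ha _ (ih x hx)
      push_cast
      rwa [show x + (r + 1) * a = x + r * a + a by ring]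
  obtain ⟨r, s, hrs⟩ := hco
  -- the coefficient of `a` may be taken nonnegative, by adding a multiple of `m`
  let N : ℤ := (y - x₀) * r
  have hN : 0 ≤ N + |N| * m := by
    have h1 := neg_abs_le N
    have h2 : |N| * 1 ≤ |N| * m := mul_le_mul_of_nonneg_left (by exact_mod_cast hm) (abs_nonneg N)
    linarith
  have h1 := hper _ ((y - x₀) * s - |N| * a) (hmul (N + |N| * m).toNat x₀ h0)
  rw [Int.toNat_of_nonneg hN] at h1
  convert h1 using 1
  simp only [N]
  linear_combination (-(y - x₀)) * hrs

/-! ### Laps all of whose chords are colored near their start -/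

section

variable {c : V → V → κ} {m : ℕ}

/-- If some chord of length `L` takes its color from its last `q` edges, then all do as soon as this
property propagates along the lap, and then the chords of the reversed lap take their colors from
their first `q` edges. -/
lemma RainbowLap.exists_low_of_closed (hc : ∀ x y, c x y = c y x) {v : ℤ → V}
    (h : RainbowLap c m v) (hm : 0 < m) {q L a : ℤ} (hco : IsCoprime a m)
    (hcl : ∀ x, ¬ ChordColor c v L 0 q x → ChordColor c v L (L - q) L (x + a))
    (hqL : 2 * q ≤ L) (hLm : L ≤ m) :
    ∃ w, RainbowLap c m w ∧ ∀ x, ChordColor c w L 0 q x := by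
  by_cases hall : ∀ x, ChordColor c v L 0 q x
  · exact ⟨v, h, hall⟩
  push Not at hall
  obtain ⟨x₀, hx₀⟩ := hall
  have hhigh : ∀ x, ChordColor c v L (L - q) L x := by
    refine forall_of_closed (S := ChordColor c v L (L - q) L) hm
      (fun x r hx => h.chordColor_periodic r hx) hco (fun x hx => hcl x fun hlow => ?_) (hcl x₀ hx₀)
    exact h.not_chordColor_of_le le_rfl (by omega) hLm hlow hx
  refine ⟨fun x => v (-x), h.reverse hc, fun x => ?_⟩
  have := RainbowLap.chordColor_reverse hc (hhigh (-x - L))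
  rwa [sub_self, sub_sub_cancel] at this

/-- The chords of length `a * k + 1` of a lap, when cycles of length `k + 2` are forbidden. -/
lemma RainbowLap.chordColor_mul (hc : ∀ x y, c x y = c y x) {v : ℤ → V}
    (h : RainbowLap c m v) {k : ℕ} (hk : ¬ HasRainbowCycle c (k + 2)) (a : ℕ) (ha : 0 < a)
    (ham : a * k + 1 < m) (x : ℤ) : ChordColor c v (a * k + 1) 0 (a * k + 1) x := by
  have hak : ¬ HasRainbowCycle c (a * k + 2) := by
    clear ham
    induction a, ha using Nat.le_induction with
    | base => simpa using hk
    | succ a ha ih =>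
      have := not_hasRainbowCycle_add hc ih hk
      rwa [show (a + 1) * k = a * k + k by ring]
  simpa using h.chordColor hc hak ham x

/-- Two chords of lengths `a * k + 1` and `b * k + 1`, with `k` edges of the lap, form a cycle of
length `k + 2` that winds once around the lap, first with an overshoot of `q`. Using this cycle
twice, the property of a chord not to take its color from its first `q` edges propagates by `k`. -/
lemma RainbowLap.exists_low_of_two_chords (hc : ∀ x y, c x y = c y x) {v : ℤ → V}
    (h : RainbowLap c m v) {k q a b : ℕ} (hk : ¬ HasRainbowCycle c (k + 2))
    (ha : 0 < a) (hb : 0 < b) (hqk : q < k) (hqa : 2 * q ≤ a * k + 1) (hqb : 2 * q ≤ b * k + 1)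
    (hm : m + 2 * q = a * k + 1 + (b * k + 1) + k) (hco : IsCoprime (k : ℤ) m) :
    ∃ w, RainbowLap c m w ∧ (∀ x, ChordColor c w (a * k + 1) 0 q x) := by
  obtain ⟨p, hp⟩ : ∃ p, k = p + q + 1 := ⟨k - q - 1, by omega⟩
  have hak : k ≤ a * k := Nat.le_mul_of_pos_left k ha
  have hbk : k ≤ b * k := Nat.le_mul_of_pos_left k hb
  have hn : ¬ HasRainbowCycle c (p + q + 3) := by
    rwa [show p + q + 3 = k + 2 by omega]
  have hA := h.chordColor_mul hc hk a ha (by omega)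
  have hB := h.chordColor_mul hc hk b hb (by omega)
  have hm' : (m : ℤ) + 2 * q = a * k + 1 + (b * k + 1) + k := by exact_mod_cast hm
  have hqa' : 2 * (q : ℤ) ≤ a * k + 1 := by exact_mod_cast hqa
  have hqb' : 2 * (q : ℤ) ≤ b * k + 1 := by exact_mod_cast hqb
  have hak' : (k : ℤ) ≤ a * k := by exact_mod_cast hak
  have hbk' : (k : ℤ) ≤ b * k := by exact_mod_cast hbk
  refine h.exists_low_of_closed hc (by omega) hco (fun x hx => ?_) hqa' (by omega)
  have h1 := h.chordColor_last hc hn (L₁ := a * k + 1) (L₂ := 1) (L₃ := b * k + 1)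
    (by omega) (by omega) one_pos (by omega) hA (chordColor_one c v) hB hx
  have h2 := h.chordColor_last hc hn (L₁ := b * k + 1) (L₂ := 1) (L₃ := a * k + 1)
    (by omega) (by omega) one_pos (by omega) hB (chordColor_one c v) hA
    (fun hlow => h.not_chordColor_of_le le_rfl (by omega) (by omega) hlow h1)
  have h3 := h.chordColor_periodic 1 h2
  convert h3 using 1
  omega

end

/-! ### Rainbow cycles that wind several times around a lap -/

section

variable {c : V → V → κ}

/-- If cycles of length `k + 2` with `k = 2 * h` are forbidden, then so are cycles of length
`m = 4 * k - 2`. Two chords of length `2 * k + 1` in a row amount to a step by `4`; the rainbow cycle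
consists of `k - 3` of these chords, followed by five edges. Its chords start at `0, 4, 8, …` and
`2 * k + 1, 2 * k + 5, …`, and each takes its color from one of its first two edges. -/
lemma not_hasRainbowCycle_four_mul_sub_two (hc : ∀ x y, c x y = c y x) {h m : ℕ} (hh : 2 ≤ h)
    (hk : ¬ HasRainbowCycle c (2 * h + 2)) (hm : m + 2 = 8 * h) : ¬ HasRainbowCycle c m := by
  intro hcyc
  obtain ⟨v₀, hv₀⟩ := hcyc.exists_lap (by omega)
  obtain ⟨v, hv, hlow⟩ : ∃ v, RainbowLap c m v ∧ ∀ x, ChordColor c v (4 * h + 1) 0 2 x := by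
    have hn : ¬ HasRainbowCycle c (2 * h - 3 + 2 + 3) := by
      rwa [show 2 * h - 3 + 2 + 3 = 2 * h + 2 by omega]
    have hd : ∀ x, ChordColor c v₀ (2 * h + 1) 0 (2 * h + 1) x := by
      simpa using hv₀.chordColor_mul hc hk 1 one_pos (by omega)
    have hD : ∀ x, ChordColor c v₀ (4 * h + 1) 0 (4 * h + 1) x := by
      have := hv₀.chordColor_mul hc hk 2 two_pos (by omega)
      push_cast at this
      rwa [show (2 : ℤ) * (2 * h) + 1 = 4 * h + 1 by ring] at this
    have hp : ((2 * h - 3 : ℕ) : ℤ) = 2 * h - 3 := by omega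
    -- the property of taking the color from the last two edges propagates from a long chord to a
    -- short one, to another short one, and back to the next long chord
    refine hv₀.exists_low_of_closed hc (by omega) (q := 2) (L := 4 * h + 1) (a := 1)
      isCoprime_one_left (fun x hx => ?_)
      (by omega) (by omega)
    have h1 := hv₀.chordColor_last hc hn (L₁ := 4 * h + 1) (L₂ := 1) (L₃ := 2 * h + 1)
      (by omega) (by omega) one_pos (by omega) hD (chordColor_one c v₀) hd (by exact_mod_cast hx)
    have h2 := hv₀.chordColor_last hc hn (L₁ := 2 * h + 1) (L₂ := 2 * h + 1) (L₃ := 2 * h + 1)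
      (by omega) (by omega) (by omega) (by omega) hd hd hd
      (fun hl => hv₀.not_chordColor_of_le le_rfl (by omega) (by omega) hl h1)
    have h3 := hv₀.chordColor_last hc hn (L₁ := 2 * h + 1) (L₂ := 1) (L₃ := 4 * h + 1)
      (by omega) (by omega) one_pos (by omega) hd (chordColor_one c v₀) hD
      (fun hl => hv₀.not_chordColor_of_le le_rfl (by omega) (by omega) hl h2)
    have h4 := hv₀.chordColor_periodic 1 h3
    convert h4 using 1 <;> omega
  choose a ha0 ha hac using hlow
  refine hk (hv.hasRainbowCycle (n := 2 * h + 2)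
    (fun i => if 2 * h ≤ i + 3 then 6 * h - 4 + i else if i % 2 = 0 then 2 * i
      else 2 * i + 4 * h - 1)
    (fun i => if 2 * h ≤ i + 3 then 6 * h - 4 + i else if i % 2 = 0 then 2 * i + a (2 * i)
      else 2 * i + 4 * h - 1 + a (2 * i + 4 * h - 1)) ?_ ?_ ?_ ?_ ?_ ?_)
  · intro i hi
    split_ifs <;> omega
  · intro i hi j hj
    split_ifs <;> omega
  · refine ⟨1, ?_⟩
    rw [if_pos (by omega), if_neg (by omega), if_pos rfl]
    push_cast
    omega
  · intro i hi
    rcases (by omega : 2 * h ≤ i + 3 ∨ (i + 3 < 2 * h ∧ i % 2 = 0) ∨ (i + 4 < 2 * h ∧ i % 2 = 1))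
      with h1 | h1 | h1
    · rw [if_pos h1, if_pos (by omega), if_pos h1]
      push_cast
      rw [add_assoc]
    · simp only [if_neg (show ¬ 2 * h ≤ i + 3 by omega), if_pos h1.2]
      rw [← hac]
      congr 2
      split_ifs <;> omega
    · simp only [if_neg (show ¬ 2 * h ≤ i + 3 by omega), if_neg (show ¬ i % 2 = 0 by omega)]
      rw [if_neg (by omega), if_pos (by omega), ← hac]
      congr 1
      refine hv.vertex_eq_of_dvd ⟨-1, ?_⟩
      omega
  · intro i hi
    have e1 := ha0 (2 * i)
    have e2 := ha (2 * i)
    have e3 := ha0 (2 * i + 4 * h - 1)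
    have e4 := ha (2 * i + 4 * h - 1)
    split_ifs <;> omega
  · intro i hi j hj
    have e1 := ha0 (2 * i)
    have e2 := ha (2 * i)
    have e3 := ha0 (2 * i + 4 * h - 1)
    have e4 := ha (2 * i + 4 * h - 1)
    have f1 := ha0 (2 * j)
    have f2 := ha (2 * j)
    have f3 := ha0 (2 * j + 4 * h - 1)
    have f4 := ha (2 * j + 4 * h - 1)
    split_ifs <;> omega

/-- If cycles of length `k + 2` with `k = 2 * h + 1` are forbidden, then so are cycles of length
`m = 6 * k - 4`. Two chords of length `3 * k + 1` in a row amount to a step by `6`; the rainbow cycle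
consists of `k - 2` of these chords, followed by four edges. Its chords start at `0, 6, 12, …` and
`3 * k + 1, 3 * k + 7, …`, and each takes its color from one of its first three edges. -/
lemma not_hasRainbowCycle_six_mul_sub_four (hc : ∀ x y, c x y = c y x) {h m : ℕ} (hh : 2 ≤ h)
    (hk : ¬ HasRainbowCycle c (2 * h + 1 + 2)) (hm : m = 12 * h + 2) : ¬ HasRainbowCycle c m := by
  intro hcyc
  obtain ⟨v₀, hv₀⟩ := hcyc.exists_lap (by omega)
  have hco : IsCoprime ((2 * h + 1 : ℕ) : ℤ) m := by
    refine ⟨2 * h + 1 - 6 * (h * (h + 1)), h * (h + 1), ?_⟩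
    subst hm
    push_cast
    ring
  obtain ⟨v, hv, hlow⟩ := hv₀.exists_low_of_two_chords hc (q := 3) (a := 3) (b := 2) hk (by omega)
    (by omega) (by omega) (by omega) (by omega) (by omega) hco
  push_cast at hlow
  rw [show (3 : ℤ) * (2 * h + 1) + 1 = 6 * h + 4 by ring] at hlow
  choose a ha0 ha hac using hlow
  refine hk (hv.hasRainbowCycle (n := 2 * h + 1 + 2)
    (fun i => if 2 * h ≤ i + 1 then 10 * h - 1 + i else if i % 2 = 0 then 3 * i
      else 3 * i + 6 * h + 1)
    (fun i => if 2 * h ≤ i + 1 then 10 * h - 1 + i else if i % 2 = 0 then 3 * i + a (3 * i)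
      else 3 * i + 6 * h + 1 + a (3 * i + 6 * h + 1)) ?_ ?_ ?_ ?_ ?_ ?_)
  · intro i hi
    split_ifs <;> omega
  · intro i hi j hj
    split_ifs <;> omega
  · refine ⟨1, ?_⟩
    rw [if_pos (by omega), if_neg (by omega), if_pos rfl]
    push_cast
    omega
  · intro i hi
    rcases (by omega : 2 * h ≤ i + 1 ∨ (i + 1 < 2 * h ∧ i % 2 = 0) ∨ (i + 2 < 2 * h ∧ i % 2 = 1))
      with h1 | h1 | h1
    · rw [if_pos h1, if_pos (by omega), if_pos h1]
      push_cast
      rw [add_assoc]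
    · simp only [if_neg (show ¬ 2 * h ≤ i + 1 by omega), if_pos h1.2]
      rw [← hac]
      congr 2
      split_ifs <;> omega
    · simp only [if_neg (show ¬ 2 * h ≤ i + 1 by omega), if_neg (show ¬ i % 2 = 0 by omega)]
      rw [if_neg (by omega), if_pos (by omega), ← hac]
      congr 1
      refine hv.vertex_eq_of_dvd ⟨-1, ?_⟩
      omega
  · intro i hi
    have e1 := ha0 (3 * i)
    have e2 := ha (3 * i)
    have e3 := ha0 (3 * i + 6 * h + 1)
    have e4 := ha (3 * i + 6 * h + 1)
    split_ifs <;> omega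
  · intro i hi j hj
    have e1 := ha0 (3 * i)
    have e2 := ha (3 * i)
    have e3 := ha0 (3 * i + 6 * h + 1)
    have e4 := ha (3 * i + 6 * h + 1)
    have f1 := ha0 (3 * j)
    have f2 := ha (3 * j)
    have f3 := ha0 (3 * j + 6 * h + 1)
    have f4 := ha (3 * j + 6 * h + 1)
    split_ifs <;> omega

/-- If cycles of length `k + 2` with `k = 2 * h + 1` are forbidden, then so are cycles of length
`m = 3 * k + 1`. The chords of lengths `2 * k + 1` and `k + 1` take their colors from their first
`q = h + 1` edges. The rainbow cycle winds twice around the lap: two chords of length `2 * k + 1`,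
`q - 1` edges, a chord of length `k + 1`, and `q - 1` edges. -/
lemma not_hasRainbowCycle_three_mul_add_one (hc : ∀ x y, c x y = c y x) {h m : ℕ} (hh : 1 ≤ h)
    (hk : ¬ HasRainbowCycle c (2 * h + 1 + 2)) (hm : m = 6 * h + 4) : ¬ HasRainbowCycle c m := by
  intro hcyc
  obtain ⟨v₀, hv₀⟩ := hcyc.exists_lap (by omega)
  have hco : IsCoprime ((2 * h + 1 : ℕ) : ℤ) m := by
    refine ⟨-3, 1, ?_⟩
    subst hm
    push_cast
    ring
  obtain ⟨v, hv, hD⟩ := hv₀.exists_low_of_two_chords hc (q := h + 1) (a := 2) (b := 1) hk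
    (by omega) (by omega) (by omega) (by omega) (by omega) (by omega) hco
  push_cast at hD
  rw [show (2 : ℤ) * (2 * h + 1) + 1 = 4 * h + 3 by ring] at hD
  have hd : ∀ x, ChordColor c v (2 * h + 2) 0 (h + 1) x := by
    have hn : ¬ HasRainbowCycle c (h - 1 + (h + 1) + 3) := by
      rwa [show h - 1 + (h + 1) + 3 = 2 * h + 1 + 2 by omega]
    have h₁ : ∀ x, ChordColor c v (2 * h + 2) 0 (2 * h + 2) x := by
      have := hv.chordColor_mul hc hk 1 one_pos (by omega)
      push_cast at this
      rwa [show (1 : ℤ) * (2 * h + 1) + 1 = 2 * h + 2 by ring] at this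
    intro x
    by_contra hx
    have := hv.chordColor_last hc hn (L₁ := 2 * h + 2) (L₂ := 1) (L₃ := 4 * h + 3)
      (by omega) (by omega) one_pos (by omega) h₁ (chordColor_one c v)
      (fun x => (hD x).mono le_rfl (by omega)) (by exact_mod_cast hx)
    exact hv.not_chordColor_of_le le_rfl (by omega) (by omega) (hD _) this
  obtain ⟨a, ha0, ha, hac⟩ := hD 0
  obtain ⟨b, hb0, hb, hbc⟩ := hD (4 * h + 3)
  obtain ⟨g, hg0, hg, hgc⟩ := hd (3 * h + 2)
  refine hk (hv.hasRainbowCycle (n := 2 * h + 1 + 2)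
    (fun i => if i = 0 then 0 else if i = 1 then 4 * h + 3 else if i ≤ h + 2 then 2 * h + i
      else 4 * h + 1 + i)
    (fun i => if i = 0 then a else if i = 1 then 4 * h + 3 + b else if i ≤ h + 1 then 2 * h + i
      else if i = h + 2 then 3 * h + 2 + g else 4 * h + 1 + i) ?_ ?_ ?_ ?_ ?_ ?_)
  · intro i hi
    split_ifs <;> omega
  · intro i hi j hj
    split_ifs <;> omega
  · refine ⟨1, ?_⟩
    rw [if_neg (by omega), if_neg (by omega), if_neg (by omega), if_pos rfl]
    push_cast
    omega
  · intro i hi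
    rcases (by omega : i = 0 ∨ i = 1 ∨ (2 ≤ i ∧ i ≤ h + 1) ∨ i = h + 2 ∨ h + 3 ≤ i)
      with rfl | rfl | h1 | rfl | h1
    · simpa using hac
    · have : v (4 * h + 3 + (4 * h + 3)) = v (2 * h + 2) :=
        hv.vertex_eq_of_dvd ⟨1, by subst hm; push_cast; ring⟩
      rw [this] at hbc
      simpa using hbc
    · rw [if_neg (by omega), if_neg (by omega), if_pos (by omega), if_neg (by omega),
        if_neg (by omega), if_pos (by omega), if_neg (by omega), if_neg (by omega), if_pos h1.2]
      push_cast
      rw [add_assoc]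
    · rw [if_neg (by omega), if_neg (by omega), if_pos (by omega), if_neg (by omega),
        if_neg (by omega), if_neg (by omega), if_neg (by omega), if_neg (by omega),
        if_neg (by omega), if_pos rfl, ← hgc]
      congr 2 <;> push_cast <;> ring
    · rw [if_neg (by omega), if_neg (by omega), if_neg (by omega), if_neg (by omega),
        if_neg (by omega), if_neg (by omega), if_neg (by omega), if_neg (by omega),
        if_neg (by omega), if_neg (by omega)]
      push_cast
      congr 2
  · intro i hi
    split_ifs <;> omega
  · intro i hi j hj
    split_ifs <;> omega

/-- The rainbow cycle consists of seven chords of length `16`, which start at multiples of four and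
take their colors from their first two edges. -/
lemma not_hasRainbowCycle_twentyEight_of_seven (hc : ∀ x y, c x y = c y x)
    (hk : ¬ HasRainbowCycle c 7) : ¬ HasRainbowCycle c 28 := by
  intro hcyc
  obtain ⟨v₀, hv₀⟩ := hcyc.exists_lap (by omega)
  have hco : IsCoprime ((5 : ℕ) : ℤ) (28 : ℕ) := ⟨-11, 2, by norm_num⟩
  obtain ⟨v, hv, hlow⟩ := hv₀.exists_low_of_two_chords hc (q := 2) (a := 3) (b := 2) hk (by omega)
    (by omega) (by omega) (by omega) (by omega) (by omega) hco
  norm_num at hlow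
  choose a ha0 ha hac using hlow
  refine hk (hv.hasRainbowCycle (n := 7) (fun i => 16 * i % 28)
    (fun i => 16 * i % 28 + a (16 * i % 28)) ?_ ?_ ?_ ?_ ?_ ?_)
  · intro i hi
    omega
  · intro i hi j hj
    omega
  · norm_num
  · intro i hi
    rw [← hac]
    congr 1
    refine hv.vertex_eq_of_dvd ?_
    push_cast
    omega
  · intro i hi
    have e1 := ha0 (16 * i % 28)
    have e2 := ha (16 * i % 28)
    omega
  · intro i hi j hj
    have e1 := ha0 (16 * i % 28)
    have e2 := ha (16 * i % 28)
    have f1 := ha0 (16 * j % 28)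
    have f2 := ha (16 * j % 28)
    omega

/-- The rainbow cycle consists of three edges and four chords of length `21`, which start at
`3, 24, 16, 8` and take their colors from their first four edges. -/
lemma not_hasRainbowCycle_twentyNine_of_seven (hc : ∀ x y, c x y = c y x)
    (hk : ¬ HasRainbowCycle c 7) : ¬ HasRainbowCycle c 29 := by
  intro hcyc
  obtain ⟨v₀, hv₀⟩ := hcyc.exists_lap (by omega)
  have hco : IsCoprime ((5 : ℕ) : ℤ) (29 : ℕ) := ⟨6, -1, by norm_num⟩
  obtain ⟨v, hv, hlow⟩ := hv₀.exists_low_of_two_chords hc (q := 4) (a := 4) (b := 2) hk (by omega)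
    (by omega) (by omega) (by omega) (by omega) (by omega) hco
  norm_num at hlow
  choose a ha0 ha hac using hlow
  refine hk (hv.hasRainbowCycle (n := 7)
    (fun i => if i ≤ 3 then i else 56 - 8 * i)
    (fun i => if i < 3 then i else if i = 3 then 3 + a 3 else 56 - 8 * i + a (56 - 8 * i))
    ?_ ?_ ?_ ?_ ?_ ?_)
  · intro i hi
    split_ifs <;> omega
  · intro i hi j hj
    split_ifs <;> omega
  · norm_num
  · intro i hi
    rcases (by omega : i < 3 ∨ i = 3 ∨ 4 ≤ i) with h1 | rfl | h1
    · rw [if_pos (by omega), if_pos (by omega), if_pos h1]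
      push_cast
      rfl
    · simpa using hac 3
    · rw [if_neg (by omega), if_neg (by omega), if_neg (by omega), if_neg (by omega), ← hac]
      congr 1
      refine hv.vertex_eq_of_dvd ⟨-1, ?_⟩
      push_cast
      ring
  · intro i hi
    have e1 := ha0 3
    have e2 := ha 3
    have e3 := ha0 (56 - 8 * i)
    have e4 := ha (56 - 8 * i)
    split_ifs <;> omega
  · intro i hi j hj
    have e1 := ha0 3
    have e2 := ha 3
    have e3 := ha0 (56 - 8 * i)
    have e4 := ha (56 - 8 * i)
    have f3 := ha0 (56 - 8 * j)
    have f4 := ha (56 - 8 * j)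
    split_ifs <;> omega

end

/-! ### Rainbow cycles of length nine contain rainbow cycles of length five -/

section

variable {c : V → V → κ} {v : ℤ → V}

/-- If there is no rainbow cycle of length five, an edge that closes up a rainbow path of four edges
repeats a color of this path. -/
lemma color_of_path (h : RainbowLap c 9 v) (hn : ¬ HasRainbowCycle c 5) (p k : ℕ → ℤ)
    (hp : ∀ i < 5, ∀ j < 5, p i % 9 = p j % 9 → i = j)
    (hk : ∀ i < 4, ∀ j < 4, k i % 9 = k j % 9 → i = j)
    (hpk : ∀ i < 4, c (v (p i)) (v (p (i + 1))) = c (v (k i)) (v (k i + 1))) :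
    ∃ i < 4, c (v (p 4)) (v (p 0)) = c (v (k i)) (v (k i + 1)) := by
  by_contra! hcon
  refine hn ⟨fun i => if i < 5 then v (p i) else v (p 0), rfl, ?_, ?_⟩
  · intro i hi j hj hij
    rw [Set.mem_Iio] at hi hj
    simp only [hi, hj, if_true] at hij
    have := h.dvd_of_vertex_eq _ _ hij
    exact hp i hi j hj (by omega)
  · have hcol : ∀ i < 4, c (if i < 5 then v (p i) else v (p 0))
        (if i + 1 < 5 then v (p (i + 1)) else v (p 0)) = c (v (k i)) (v (k i + 1)) := by
      intro i hi
      rw [if_pos (by omega), if_pos (by omega), hpk i hi]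
    intro i hi j hj hij
    rw [Set.mem_Iio] at hi hj
    simp only at hij
    rcases (by omega : i < 4 ∨ i = 4) with hi' | rfl <;>
      rcases (by omega : j < 4 ∨ j = 4) with hj' | rfl
    · rw [hcol i hi', hcol j hj'] at hij
      have := h.dvd_of_color_eq _ _ hij
      exact hk i hi' j hj' (by omega)
    · rw [hcol i hi'] at hij
      exact absurd hij.symm (hcon i hi')
    · rw [hcol j hj'] at hij
      exact absurd hij (hcon j hj')
    · rfl

/-- The version of `color_of_path` for a path that is given by its list of vertices and the list of
the colors of its edges. -/
lemma color_of_path_list (h : RainbowLap c 9 v) (hn : ¬ HasRainbowCycle c 5)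
    (p₀ p₁ p₂ p₃ p₄ k₀ k₁ k₂ k₃ : ℤ)
    (hp : ∀ i < 5, ∀ j < 5,
      [p₀, p₁, p₂, p₃, p₄].getD i 0 % 9 = [p₀, p₁, p₂, p₃, p₄].getD j 0 % 9 → i = j)
    (hk : ∀ i < 4, ∀ j < 4,
      [k₀, k₁, k₂, k₃].getD i 0 % 9 = [k₀, k₁, k₂, k₃].getD j 0 % 9 → i = j)
    (h₀ : c (v p₀) (v p₁) = c (v k₀) (v (k₀ + 1))) (h₁ : c (v p₁) (v p₂) = c (v k₁) (v (k₁ + 1)))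
    (h₂ : c (v p₂) (v p₃) = c (v k₂) (v (k₂ + 1)))
    (h₃ : c (v p₃) (v p₄) = c (v k₃) (v (k₃ + 1))) :
    ∃ k ∈ [k₀, k₁, k₂, k₃], c (v p₄) (v p₀) = c (v k) (v (k + 1)) := by
  obtain ⟨i, hi, hik⟩ := color_of_path h hn ([p₀, p₁, p₂, p₃, p₄].getD · 0)
    ([k₀, k₁, k₂, k₃].getD · 0) hp hk (by intro i hi; interval_cases i <;> assumption)
  refine ⟨_, ?_, hik⟩
  interval_cases i <;> simp

/-- The color of an edge of the lap, in either direction and for any choice of the residues. -/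
lemma RainbowLap.color_edge (hc : ∀ x y, c x y = c y x) (h : RainbowLap c 9 v) {a b : ℤ}
    (hab : (9 : ℤ) ∣ b - a - 1) : c (v a) (v b) = c (v a) (v (a + 1)) ∧
      c (v b) (v a) = c (v a) (v (a + 1)) := by
  have : v b = v (a + 1) := h.vertex_eq_of_dvd (by push_cast; omega)
  rw [hc (v b), this]
  exact ⟨rfl, rfl⟩

/-- The color of a chord of length four, in either direction and for any choice of the residues. -/
lemma RainbowLap.color_chord (hc : ∀ x y, c x y = c y x) (h : RainbowLap c 9 v) {a b t : ℤ}
    (hab : (9 : ℤ) ∣ b - a - 4) (ht : ChordColor c v 4 t (t + 1) a) :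
    c (v a) (v b) = c (v (a + t)) (v (a + t + 1)) ∧
      c (v b) (v a) = c (v (a + t)) (v (a + t + 1)) := by
  have : v b = v (a + 4) := h.vertex_eq_of_dvd (by push_cast; omega)
  obtain ⟨r, h1, h2, h3⟩ := ht
  obtain rfl : r = t := by omega
  rw [hc (v b), this]
  exact ⟨h3, h3⟩

/-- Each chord of length four that starts at a multiple of three has the color of its last edge, and
each one that starts right after a multiple of three has the color of its first edge. Then the chord from `0` to `3` closes up three
rainbow paths of four edges that have no color in common. -/
lemma false_of_mixed (hc : ∀ x y, c x y = c y x) (h : RainbowLap c 9 v)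
    (hn : ¬ HasRainbowCycle c 5) (h0 : ∀ z, ChordColor c v 4 3 4 (3 * z))
    (h1 : ∀ z, ChordColor c v 4 0 1 (3 * z + 1)) : False := by
  have edge : ∀ a b : ℤ, (9 : ℤ) ∣ b - a - 1 → _ := fun a b => h.color_edge hc (a := a) (b := b)
  obtain ⟨k, hk, hke⟩ := color_of_path_list h hn 3 4 5 1 0 3 4 1 0 (by decide) (by decide)
    (edge 3 4 (by decide)).1 (edge 4 5 (by decide)).1
    (h.color_chord hc (by decide) (h1 0)).2 (edge 0 1 (by decide)).2
  obtain ⟨l, hl, hle⟩ := color_of_path_list h hn 3 7 2 1 0 6 7 1 0 (by decide) (by decide)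
    (h.color_chord hc (by decide) (h0 1)).1 (h.color_chord hc (by decide) (h1 2)).1
    (edge 1 2 (by decide)).2 (edge 0 1 (by decide)).2
  obtain ⟨r, hr, hre⟩ := color_of_path_list h hn 3 7 8 4 0 6 7 4 3 (by decide) (by decide)
    (h.color_chord hc (by decide) (h0 1)).1 (edge 7 8 (by decide)).1
    (h.color_chord hc (by decide) (h1 1)).2 (h.color_chord hc (by decide) (h0 0)).2
  have hkl := h.dvd_of_color_eq _ _ (hke.symm.trans hle)
  have hkr := h.dvd_of_color_eq _ _ (hke.symm.trans hre)
  simp only [List.mem_cons, List.not_mem_nil, or_false] at hk hl hr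
  omega

/-- Each chord of length four has the color of its first edge. Then a chord of length three has the
color of its first edge or of the edge that follows it, and two consecutive chords of length three
are not of the same kind. This is impossible for the three chords of a triangle. -/
lemma false_of_low (hc : ∀ x y, c x y = c y x) (h : RainbowLap c 9 v)
    (hn : ¬ HasRainbowCycle c 5) (hlow : ∀ x, ChordColor c v 4 0 1 x) : False := by
  have key : ∀ w, RainbowLap c 9 w → (∀ x, ChordColor c w 4 0 1 x) →
      (c (w 0) (w 3) = c (w 0) (w 1) ∨ c (w 0) (w 3) = c (w 3) (w 4)) ∧
      ¬ (c (w 0) (w 3) = c (w 0) (w 1) ∧ c (w 3) (w 6) = c (w 3) (w 4)) ∧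
      ¬ (c (w 0) (w 3) = c (w 3) (w 4) ∧ c (w 3) (w 6) = c (w 6) (w 7)) := by
    intro w hw hlow
    have edge : ∀ a b : ℤ, (9 : ℤ) ∣ b - a - 1 → _ := fun a b => hw.color_edge hc (a := a) (b := b)
    have chord : ∀ a b : ℤ, (9 : ℤ) ∣ b - a - 4 → c (w a) (w b) = c (w a) (w (a + 1)) ∧
        c (w b) (w a) = c (w a) (w (a + 1)) := fun a b hab => by
      have := hw.color_chord hc (t := 0) hab (by rw [zero_add]; exact hlow a)
      rwa [add_zero] at this
    refine ⟨?_, ?_, ?_⟩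
    · obtain ⟨k, hk, hke⟩ := color_of_path_list hw hn 3 4 5 1 0 3 4 1 0 (by decide) (by decide)
        (edge 3 4 (by decide)).1 (edge 4 5 (by decide)).1 (chord 1 5 (by decide)).2
        (edge 0 1 (by decide)).2
      obtain ⟨l, hl, hle⟩ := color_of_path_list hw hn 3 7 2 1 0 3 7 1 0 (by decide) (by decide)
        (chord 3 7 (by decide)).1 (chord 7 2 (by decide)).1 (edge 1 2 (by decide)).2
        (edge 0 1 (by decide)).2
      obtain ⟨r, hr, hre⟩ := color_of_path_list hw hn 3 7 8 4 0 3 7 4 0 (by decide) (by decide)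
        (chord 3 7 (by decide)).1 (edge 7 8 (by decide)).1 (chord 4 8 (by decide)).2
        (chord 0 4 (by decide)).2
      have hkl := hw.dvd_of_color_eq _ _ (hke.symm.trans hle)
      have hkr := hw.dvd_of_color_eq _ _ (hke.symm.trans hre)
      simp only [List.mem_cons, List.not_mem_nil, or_false] at hk hl hr
      obtain rfl | rfl : k = 0 ∨ k = 3 := by omega
      · exact .inl hke
      · exact .inr hke
    · rintro ⟨h1, h2⟩
      obtain ⟨k, hk, hke⟩ := color_of_path_list hw hn 6 7 8 0 3 6 7 8 0 (by decide) (by decide)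
        (edge 6 7 (by decide)).1 (edge 7 8 (by decide)).1 (edge 8 0 (by decide)).1 h1
      have := hw.dvd_of_color_eq 3 k (h2.symm.trans hke)
      simp only [List.mem_cons, List.not_mem_nil, or_false] at hk
      omega
    · rintro ⟨h1, h2⟩
      obtain ⟨k, hk, hke⟩ := color_of_path_list hw hn 3 0 1 2 6 3 0 1 2 (by decide) (by decide)
        ((hc _ _).trans h1) (edge 0 1 (by decide)).1 (edge 1 2 (by decide)).1
        (chord 2 6 (by decide)).1
      have := hw.dvd_of_color_eq 6 k ((h2.symm.trans (hc _ _)).trans hke)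
      simp only [List.mem_cons, List.not_mem_nil, or_false] at hk
      omega
  have key' := fun s => key _ (h.shift s) fun x => by
    obtain ⟨t, h1, h2, h3⟩ := hlow (x + s)
    refine ⟨t, h1, h2, ?_⟩
    convert h3 using 3 <;> ring
  have k0 := key' 0
  have k3 := key' 3
  have k6 := key' 6
  have k9 : ∀ x, v (9 + x) = v x := fun x => h.vertex_eq_of_dvd ⟨1, by push_cast; ring⟩
  have e9 := k9 0
  have e10 := k9 1
  have e12 := k9 3
  have e13 := k9 4
  norm_num at k0 k3 k6 e9 e10 e12 e13
  rw [e9, e10] at k3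
  rw [e9, e10, e12, e13] at k6
  tauto

/-- A chord of length four has the color of its first or of its last edge, and which of the two
holds depends only on its starting point modulo three. -/
lemma not_hasRainbowCycle_nine_of_five (hc : ∀ x y, c x y = c y x)
    (hn : ¬ HasRainbowCycle c 5) : ¬ HasRainbowCycle c 9 := by
  intro hcyc
  obtain ⟨v, h⟩ := hcyc.exists_lap (by omega)
  have hall : ∀ x, ChordColor c v 4 0 4 x := by
    simpa using h.chordColor_mul hc (k := 3) hn 1 one_pos (by omega)
  have hstep : ∀ x, ¬ ChordColor c v 4 0 1 x → ChordColor c v 4 3 4 (x - 3) := fun x hx => by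
    have := h.chordColor_last hc (p := 1) (q := 1) (L₁ := 4) (L₂ := 1) (L₃ := 4) hn (by norm_num)
      (by norm_num) (by norm_num) (by norm_num) hall (chordColor_one c v) hall
      (by exact_mod_cast hx)
    convert this using 1
    push_cast
    ring
  have hnot : ∀ x, ChordColor c v 4 3 4 x → ¬ ChordColor c v 4 0 1 x := fun x hx hlow =>
    h.not_chordColor_of_le le_rfl (by norm_num) (by norm_num) hlow hx
  -- the chords whose starting points lie in a residue class modulo three behave in the same way
  have hclass : ∀ r, (∀ z, ChordColor c v 4 0 1 (3 * z + r)) ∨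
      ∀ z, ChordColor c v 4 3 4 (3 * z + r) := by
    intro r
    by_cases hr : ∀ z, ChordColor c v 4 0 1 (3 * z + r)
    · exact .inl hr
    push Not at hr
    obtain ⟨z₀, hz₀⟩ := hr
    refine .inr (forall_of_closed (S := fun z => ChordColor c v 4 3 4 (3 * z + r))
      (m := 3) (a := -1) (x₀ := z₀ - 1) (by norm_num) (fun x s hx => ?_) ⟨-1, 0, by norm_num⟩
      (fun x hx => ?_) ?_)
    · have := h.chordColor_periodic s hx
      convert this using 1
      push_cast
      ring
    · have := hstep _ (hnot _ hx)
      convert this using 1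
      ring
    · have := hstep _ hz₀
      convert this using 1
      ring
  have hmixed : ∀ r, (∀ z, ChordColor c v 4 3 4 (3 * z + r)) →
      (∀ z, ChordColor c v 4 0 1 (3 * z + (r + 1))) → False := by
    intro r h0 h1
    have hshift : ∀ {a b x}, ChordColor c v 4 a b (x + r) →
        ChordColor c (fun x => v (x + r)) 4 a b x := by
      rintro a b x ⟨t, h1, h2, h3⟩
      refine ⟨t, h1, h2, ?_⟩
      convert h3 using 3 <;> ring
    exact false_of_mixed hc (h.shift r) hn (fun z => hshift (h0 z))
      fun z => hshift (by rw [add_assoc, add_comm 1]; exact h1 z)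
  have hthree : ∀ {a b}, (∀ z, ChordColor c v 4 a b (3 * z + 0)) →
      ∀ z, ChordColor c v 4 a b (3 * z + (2 + 1)) := fun h0 z => by
    have := h0 (z + 1)
    convert this using 1
    ring
  have hresidue : ∀ {a b}, (∀ z, ChordColor c v 4 a b (3 * z + 0)) →
      (∀ z, ChordColor c v 4 a b (3 * z + 1)) → (∀ z, ChordColor c v 4 a b (3 * z + 2)) →
      ∀ x, ChordColor c v 4 a b x := by
    intro a b h0 h1 h2 x
    obtain ⟨z, hz⟩ : ∃ z, x = 3 * z + 0 ∨ x = 3 * z + 1 ∨ x = 3 * z + 2 := ⟨x / 3, by omega⟩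
    rcases hz with rfl | rfl | rfl
    exacts [h0 z, h1 z, h2 z]
  rcases hclass 0 with h0 | h0 <;> rcases hclass 1 with h1 | h1 <;> rcases hclass 2 with h2 | h2
  · exact false_of_low hc h hn (hresidue h0 h1 h2)
  · exact hmixed 2 h2 (hthree h0)
  · exact hmixed 1 h1 h2
  · exact hmixed 2 h2 (hthree h0)
  · exact hmixed 0 h0 h1
  · exact hmixed 0 h0 h1
  · exact hmixed 1 h1 h2
  · refine false_of_low hc (h.reverse hc) hn fun x => ?_
    have := RainbowLap.chordColor_reverse hc (hresidue h0 h1 h2 (-x - 4))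
    norm_num at this
    exact this

end

/-! ### The numerical semigroup of a spectrum -/

/-- The forbidden lengths, lowered by two, as a submonoid of `ℕ`. -/
noncomputable def spectrumMonoid (γ : SimpleGraph.TopEdgeLabeling V C) : AddSubmonoid ℕ where
  carrier := {t | t + 2 ∈ spectrum γ}
  zero_mem' := ⟨le_rfl, fun v w hw hl => by have := hw.three_le_length; omega⟩
  add_mem' {a b} ha hb := by
    refine mem_spectrum_of_not_hasRainbowCycle (by omega) ?_
    exact not_hasRainbowCycle_add (edgeColor_comm γ) (not_hasRainbowCycle_of_mem_spectrum ha)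
      (not_hasRainbowCycle_of_mem_spectrum hb)

lemma mem_spectrumMonoid_iff {γ : SimpleGraph.TopEdgeLabeling V C} {t : ℕ} :
    t ∈ spectrumMonoid γ ↔ ¬ HasRainbowCycle (edgeColor γ) (t + 2) :=
  ⟨fun h => not_hasRainbowCycle_of_mem_spectrum h,
    fun h => mem_spectrum_of_not_hasRainbowCycle (by omega) h⟩

lemma mul_mem_of_mem (S : AddSubmonoid ℕ) {a : ℕ} (r : ℕ) (ha : a ∈ S) : r * a ∈ S := by
  simpa using S.nsmul_mem ha r

/-- The case `k = 4 * l` of a submonoid that contains `k` and `4 * k - 4`. -/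
lemma mem_of_four_dvd (S : AddSubmonoid ℕ) {l t : ℕ} (hl : 1 ≤ l) (h₁ : 4 * l ∈ S)
    (h₂ : 16 * l - 4 ∈ S) (ht : 36 * l ^ 2 + 8 ≤ 4 * t + 36 * l) : 4 * t ∈ S := by
  obtain ⟨y, hy, s, hs⟩ : ∃ y < l, l ∣ t + y := by
    refine ⟨((l - 1) * t) % l, Nat.mod_lt _ hl, ?_⟩
    rw [Nat.dvd_iff_mod_eq_zero, Nat.add_mod_mod]
    obtain ⟨l, rfl⟩ : ∃ l', l = l' + 1 := ⟨l - 1, by omega⟩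
    simp only [Nat.add_sub_cancel]
    rw [show t + l * t = (l + 1) * t by ring, Nat.mul_mod_right]
  have hys : 4 * y ≤ s := by
    have h3 : 4 * y * l ≤ s * l := by nlinarith
    exact le_of_mul_le_mul_right h3 hl
  have := S.add_mem (mul_mem_of_mem S y h₂) (mul_mem_of_mem S (s - 4 * y) h₁)
  convert this using 1
  zify [hys, show 4 ≤ 16 * l by omega] at hs ⊢
  linear_combination 4 * hs

/-- The case `k = 4 * l + 2` of a submonoid that contains `k` and `4 * k - 4`. -/
lemma mem_of_two_dvd (S : AddSubmonoid ℕ) {l t : ℕ} (h₁ : 4 * l + 2 ∈ S)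
    (h₂ : 16 * l + 4 ∈ S) (ht : 72 * l ^ 2 ≤ 2 * t + 12 * l) : 2 * t ∈ S := by
  obtain ⟨y, hy, s, hs⟩ : ∃ y < 2 * l + 1, 2 * l + 1 ∣ t + 2 * y := by
    refine ⟨(l * t) % (2 * l + 1), Nat.mod_lt _ (by omega), ?_⟩
    have : t + 2 * (l * t % (2 * l + 1)) ≡ t + 2 * (l * t) [MOD 2 * l + 1] :=
      ((Nat.mod_modEq _ _).mul_left 2).add_left t
    refine (Nat.ModEq.dvd_iff this dvd_rfl).2 ⟨t, by ring⟩
  have hys : 4 * y ≤ s := by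
    have h3 : 4 * y * (2 * l + 1) ≤ s * (2 * l + 1) := by
      rcases Nat.eq_zero_or_pos l with rfl | hl
      · omega
      · nlinarith
    exact le_of_mul_le_mul_right h3 (by omega)
  have := S.add_mem (mul_mem_of_mem S y h₂) (mul_mem_of_mem S (s - 4 * y) h₁)
  convert this using 1
  zify [hys] at hs ⊢
  linear_combination 2 * hs

/-- The residue `-x` modulo `k`, for `x < k`, is reached by a combination of `3 * k - 1`, `6 * k - 6`
and `8 * k - 4`, which are congruent to `-1`, `-6` and `-4`, of size at most `2 * (k - 1) ^ 2`. -/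
lemma mem_of_odd (S : AddSubmonoid ℕ) {k t : ℕ} (hk : 7 ≤ k) (h₁ : k ∈ S)
    (h₂ : 3 * k - 1 ∈ S) (h₃ : 6 * k - 6 ∈ S) (h₄ : 8 * k - 4 ∈ S)
    (ht : 2 * k ^ 2 + 3 ≤ t + 5 * k) : t ∈ S := by
  obtain ⟨x, hx, s, hs⟩ : ∃ x < k, k ∣ t + x := by
    refine ⟨((k - 1) * t) % k, Nat.mod_lt _ (by omega), ?_⟩
    rw [Nat.dvd_iff_mod_eq_zero, Nat.add_mod_mod]
    obtain ⟨k, rfl⟩ : ∃ k', k = k' + 1 := ⟨k - 1, by omega⟩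
    simp only [Nat.add_sub_cancel]
    rw [show t + k * t = (k + 1) * t by ring, Nat.mul_mod_right]
  -- the residue `-x` is reached by `x / 6` copies of `6 * k - 6` and one of six combinations of
  -- `3 * k - 1` and `8 * k - 4`
  obtain ⟨e, f, hef, hcost⟩ : ∃ e f, x % 6 = e + 4 * f ∧ x - x % 6 + 3 * e + 8 * f ≤ s := by
    have key : ∀ d, d ≤ x + 6 → (k ≤ 8 → d ≤ s) → d ≤ s := by
      intro d hd h7
      by_contra hlt
      have h8 : 9 ≤ k := by
        by_contra h8
        exact hlt (h7 (by omega))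
      have h9 : k * s ≤ k * (x + 5) := Nat.mul_le_mul_left k (by omega)
      nlinarith
    refine ⟨x % 6 % 4, x % 6 / 4, by omega, key _ (by omega) fun h8 => ?_⟩
    obtain rfl | rfl : k = 7 ∨ k = 8 := by omega
    · omega
    · omega
  have hx6 : 6 * (x / 6) + x % 6 = x := Nat.div_add_mod x 6
  have := S.add_mem (S.add_mem (mul_mem_of_mem S (x / 6) h₃) (mul_mem_of_mem S e h₂))
    (S.add_mem (mul_mem_of_mem S f h₄)
      (mul_mem_of_mem S (s - (6 * (x / 6) + 3 * e + 8 * f)) h₁))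
  convert this using 1
  zify [show 6 * (x / 6) + 3 * e + 8 * f ≤ s by omega, show 6 ≤ 6 * k by omega,
    show 1 ≤ 3 * k by omega, show 4 ≤ 8 * k by omega] at hs hef hx6 ⊢
  linear_combination hs + hx6 - hef

/-! ### Progressions in the spectrum -/

section

variable {γ : SimpleGraph.TopEdgeLabeling V C}

lemma containsProgression_of_mem {s d : ℕ} (h : ∀ j, s + j * d ∈ spectrumMonoid γ) :
    ContainsProgression (spectrum γ) (s + 2) d := fun j => by
  have := h j
  rwa [show s + 2 + j * d = s + j * d + 2 by ring]

lemma mem_of_even {h : ℕ} (hh : 2 ≤ h) (hk : 2 * h ∈ spectrumMonoid γ) :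
    8 * h - 4 ∈ spectrumMonoid γ :=
  mem_spectrumMonoid_iff.2 <| not_hasRainbowCycle_four_mul_sub_two (edgeColor_comm γ) hh
    (mem_spectrumMonoid_iff.1 hk) (by omega)

lemma mem_spectrumMonoid_of_odd {h : ℕ} (hk : 2 * h + 1 ∈ spectrumMonoid γ) {t : ℕ}
    (ht : 8 * h ^ 2 ≤ t + 2 * h) : t ∈ spectrumMonoid γ := by
  have hc := edgeColor_comm γ
  have hk' := mem_spectrumMonoid_iff.1 hk
  rcases (by omega : h = 0 ∨ h = 1 ∨ h = 2 ∨ 3 ≤ h) with rfl | rfl | rfl | h3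
  · simpa using mul_mem_of_mem _ t hk
  · have h7 : 7 ∈ spectrumMonoid γ :=
      mem_spectrumMonoid_iff.2 (not_hasRainbowCycle_nine_of_five hc hk')
    have h8 : 8 ∈ spectrumMonoid γ :=
      mem_spectrumMonoid_iff.2 (not_hasRainbowCycle_three_mul_add_one hc le_rfl hk' rfl)
    obtain ⟨a, b, d, rfl⟩ : ∃ a b d, t = a * (2 * 1 + 1) + b * 7 + d * 8 := by
      rcases (by omega : t % 3 = 0 ∨ t % 3 = 1 ∨ t % 3 = 2) with h | h | h
      · exact ⟨t / 3, 0, 0, by omega⟩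
      · exact ⟨t / 3 - 2, 1, 0, by omega⟩
      · exact ⟨t / 3 - 2, 0, 1, by omega⟩
    exact add_mem (add_mem (mul_mem_of_mem _ a hk) (mul_mem_of_mem _ b h7)) (mul_mem_of_mem _ d h8)
  · have h14 : 14 ∈ spectrumMonoid γ :=
      mem_spectrumMonoid_iff.2 (not_hasRainbowCycle_three_mul_add_one hc one_le_two hk' rfl)
    have h26 : 26 ∈ spectrumMonoid γ :=
      mem_spectrumMonoid_iff.2 (not_hasRainbowCycle_twentyEight_of_seven hc hk')
    have h27 : 27 ∈ spectrumMonoid γ :=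
      mem_spectrumMonoid_iff.2 (not_hasRainbowCycle_twentyNine_of_seven hc hk')
    obtain ⟨a, b, d, e, rfl⟩ : ∃ a b d e, t = a * (2 * 2 + 1) + b * 14 + d * 26 + e * 27 := by
      rcases (by omega : t % 5 = 0 ∨ t % 5 = 1 ∨ t % 5 = 2 ∨ t % 5 = 3 ∨ t % 5 = 4)
        with h | h | h | h | h
      · exact ⟨t / 5, 0, 0, 0, by omega⟩
      · exact ⟨t / 5 - 5, 0, 1, 0, by omega⟩
      · exact ⟨t / 5 - 5, 0, 0, 1, by omega⟩
      · exact ⟨t / 5 - 5, 2, 0, 0, by omega⟩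
      · exact ⟨t / 5 - 2, 1, 0, 0, by omega⟩
    exact add_mem (add_mem (add_mem (mul_mem_of_mem _ a hk) (mul_mem_of_mem _ b h14))
      (mul_mem_of_mem _ d h26)) (mul_mem_of_mem _ e h27)
  · refine mem_of_odd _ (k := 2 * h + 1) (by omega) hk ?_ ?_ ?_ (by nlinarith)
    · exact mem_spectrumMonoid_iff.2
        (not_hasRainbowCycle_three_mul_add_one hc (by omega) hk' (by omega))
    · exact mem_spectrumMonoid_iff.2
        (not_hasRainbowCycle_six_mul_sub_four hc (by omega) hk' (by omega))
    · exact mem_of_even (h := 2 * h + 1) (by omega) (mul_mem_of_mem _ 2 hk)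

lemma containsProgression_of_odd {h : ℕ} (hn : 2 * h + 3 ∈ spectrum γ) :
    ContainsProgression (spectrum γ) (8 * h ^ 2 - 2 * h + 2) 1 := by
  refine containsProgression_of_mem fun j => mem_spectrumMonoid_of_odd (h := h) hn ?_
  omega

lemma containsProgression_of_two_mod_four {l : ℕ} (hl : 1 ≤ l) (hn : 4 * l + 2 ∈ spectrum γ) :
    ContainsProgression (spectrum γ) (4 * (9 * l ^ 2 - 9 * l + 2) + 2) 4 := by
  refine containsProgression_of_mem fun j => ?_
  rw [show 4 * (9 * l ^ 2 - 9 * l + 2) + j * 4 = 4 * (9 * l ^ 2 - 9 * l + 2 + j) by ring]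
  refine mem_of_four_dvd _ hl hn ?_ (by omega)
  have := mem_of_even (γ := γ) (h := 2 * l) (by omega) (by rwa [← mul_assoc])
  rwa [← mul_assoc] at this

lemma containsProgression_of_four_dvd {l : ℕ} (hn : 4 * l + 4 ∈ spectrum γ) :
    ContainsProgression (spectrum γ) (2 * (36 * l ^ 2 - 6 * l) + 2) 2 := by
  refine containsProgression_of_mem fun j => ?_
  rw [show 2 * (36 * l ^ 2 - 6 * l) + j * 2 = 2 * (36 * l ^ 2 - 6 * l + j) by ring]
  refine mem_of_two_dvd _ hn ?_ (by omega)
  rcases Nat.eq_zero_or_pos l with rfl | hl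
  · exact mul_mem_of_mem (spectrumMonoid γ) (a := 2) 2 hn
  · have := mem_of_even (γ := γ) (h := 2 * l + 1) (by omega)
      (by rwa [show 2 * (2 * l + 1) = 4 * l + 2 by ring])
    rwa [show 8 * (2 * l + 1) - 4 = 16 * l + 4 by omega] at this

/-- For `d = 1, 2, 4` the least difference of a progression divides the difference `d`: the only
smaller number that does not divide it is `3`, next to `d = 4`. -/
lemma period_dvd_of_containsProgression {d : ℕ} (hd : d = 1 ∨ d = 2 ∨ d = 4) {N : ℕ}
    (h : ContainsProgression (spectrum γ) N d) : period (spectrum γ) ∣ d := by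
  have hmem : d ∈ {d | 0 < d ∧ ∃ N, ContainsProgression (spectrum γ) N d} :=
    ⟨by omega, N, h⟩
  obtain ⟨hpos, N', h'⟩ := Nat.sInf_mem ⟨d, hmem⟩
  have hle := Nat.sInf_le hmem
  change 0 < period (spectrum γ) at hpos
  change ContainsProgression (spectrum γ) N' (period (spectrum γ)) at h'
  change period (spectrum γ) ≤ d at hle
  rcases (by omega : period (spectrum γ) = 1 ∨ period (spectrum γ) = 2 ∨
    period (spectrum γ) = 3 ∨ period (spectrum γ) = 4) with hp | hp | hp | hp
  · simp [hp]
  · rw [hp] at hle ⊢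
    omega
  · -- progressions with differences `3` and `4` sum up to all numbers from some point on
    rw [hp] at hle h'
    obtain rfl : d = 4 := by omega
    have h2 : 2 ≤ N := by simpa using (h 0).1
    have h2' : 2 ≤ N' := by simpa using (h' 0).1
    have hmon : ∀ {N d}, 2 ≤ N → ContainsProgression (spectrum γ) N d →
        ∀ j, N - 2 + j * d ∈ spectrumMonoid γ := fun {N d} hN h j => by
      change N - 2 + j * d + 2 ∈ spectrum γ
      rw [show N - 2 + j * d + 2 = N + j * d by omega]
      exact h j
    have hone : 1 ∈ {d | 0 < d ∧ ∃ N, ContainsProgression (spectrum γ) N d} := by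
      refine ⟨one_pos, N - 2 + (N' - 2) + 6 + 2, containsProgression_of_mem fun j => ?_⟩
      obtain ⟨a, b, hab⟩ : ∃ a b, j + 6 = a * 4 + b * 3 := by
        rcases (by omega : j % 3 = 0 ∨ j % 3 = 1 ∨ j % 3 = 2) with h | h | h
        · exact ⟨0, j / 3 + 2, by omega⟩
        · exact ⟨1, j / 3 + 1, by omega⟩
        · exact ⟨2, j / 3, by omega⟩
      have := add_mem (hmon h2 h a) (hmon h2' h' b)
      convert this using 1
      omega
    have : period (spectrum γ) ≤ 1 := Nat.sInf_le hone
    omega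
  · rw [hp] at hle ⊢
    omega

end

end RainbowCycle

theorem theorem5p1 {V C : Type*} [Infinite V] (γ : SimpleGraph.TopEdgeLabeling V C)
    (n : ℕ) (hn : n ∈ RainbowCycle.spectrum γ) :
    (3 ≤ n → n % 2 = 1 →
      ∃ N : ℕ, (N : ℚ) ≤ 2 * (n : ℚ) ^ 2 - 13 * n + 23 ∧
        RainbowCycle.ContainsProgression (RainbowCycle.spectrum γ) N 1) ∧
    (6 ≤ n → n % 4 = 2 →
      ∃ N : ℕ, (N : ℚ) ≤ 9 / 4 * (n : ℚ) ^ 2 - 18 * n + 37 ∧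
        RainbowCycle.ContainsProgression (RainbowCycle.spectrum γ) N 4) ∧
    (n % 4 = 0 →
      ∃ N : ℕ, (N : ℚ) ≤ 9 / 2 * (n : ℚ) ^ 2 - 39 * n + 86 ∧
        RainbowCycle.ContainsProgression (RainbowCycle.spectrum γ) N 2) ∧
    (3 ≤ n →
      RainbowCycle.period (RainbowCycle.spectrum γ) ∣ RainbowCycle.p n ∧
      RainbowCycle.period (RainbowCycle.spectrum γ) ∣ 4) := by
  have hodd : 3 ≤ n → n % 2 = 1 →
      ∃ N : ℕ, (N : ℚ) ≤ 2 * (n : ℚ) ^ 2 - 13 * n + 23 ∧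
        RainbowCycle.ContainsProgression (RainbowCycle.spectrum γ) N 1 := by
    intro h3 hmod
    obtain ⟨h, rfl⟩ : ∃ h, n = 2 * h + 3 := ⟨(n - 3) / 2, by omega⟩
    refine ⟨_, ?_, RainbowCycle.containsProgression_of_odd hn⟩
    have hle : 2 * h ≤ 8 * h ^ 2 := by nlinarith [Nat.le_self_pow two_ne_zero h]
    push_cast [hle]
    exact le_of_eq (by ring)
  have htwo : 6 ≤ n → n % 4 = 2 →
      ∃ N : ℕ, (N : ℚ) ≤ 9 / 4 * (n : ℚ) ^ 2 - 18 * n + 37 ∧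
        RainbowCycle.ContainsProgression (RainbowCycle.spectrum γ) N 4 := by
    intro h6 hmod
    obtain ⟨l, rfl⟩ : ∃ l, n = 4 * l + 2 := ⟨n / 4, by omega⟩
    refine ⟨_, ?_, RainbowCycle.containsProgression_of_two_mod_four (by omega) hn⟩
    have hle : 9 * l ≤ 9 * l ^ 2 := by nlinarith [Nat.le_self_pow two_ne_zero l]
    push_cast [hle]
    exact le_of_eq (by ring)
  have hfour : n % 4 = 0 →
      ∃ N : ℕ, (N : ℚ) ≤ 9 / 2 * (n : ℚ) ^ 2 - 39 * n + 86 ∧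
        RainbowCycle.ContainsProgression (RainbowCycle.spectrum γ) N 2 := by
    intro hmod
    obtain ⟨l, rfl⟩ : ∃ l, n = 4 * l + 4 := ⟨(n - 4) / 4, by have := hn.1; omega⟩
    refine ⟨_, ?_, RainbowCycle.containsProgression_of_four_dvd hn⟩
    have hle : 6 * l ≤ 36 * l ^ 2 := by nlinarith [Nat.le_self_pow two_ne_zero l]
    push_cast [hle]
    exact le_of_eq (by ring)
  refine ⟨hodd, htwo, hfour, fun h3 => ?_⟩
  have hdvd : RainbowCycle.period (RainbowCycle.spectrum γ) ∣ RainbowCycle.p n := by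
    unfold RainbowCycle.p
    split_ifs with h1 h2
    · obtain ⟨N, -, hN⟩ := hodd h3 h1
      exact RainbowCycle.period_dvd_of_containsProgression (by omega) hN
    · obtain ⟨N, -, hN⟩ := hfour h2
      exact RainbowCycle.period_dvd_of_containsProgression (by omega) hN
    · obtain ⟨N, -, hN⟩ := htwo (by omega) (by omega)
      exact RainbowCycle.period_dvd_of_containsProgression (by omega) hN
  refine ⟨hdvd, hdvd.trans ?_⟩
  unfold RainbowCycle.p
  split_ifs <;> decide
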